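/- Let $\mathbb{T}=\mathbb{R}/2\pi\mathbb{Z}$ be the unit circle. A function $f:\mathbb{T}\to\mathbb{R}$ is called solvable if it is a pointwise limit of a sequence of continuous functions and, for every closed $K\subseteq\mathbb{T}$, the set of discontinuity points of the restriction $f\restriction_K$ is closed. Let $SV(\mathbb{T})$ be the set of everywhere differentiable functions $y:\mathbb{T}\to\mathbb{R}$ whose derivative $y'$ is bounded and solvable. For $y\in SV(\mathbb{T})$ let $E_0=\mathbb{T}$, let $E_{\alpha+1}$ be the set of discontinuity points of $y'\restriction_{E_\alpha}$, and let $E_\lambda=\bigcap_{\beta<\lambda}E_\beta$ for limit ordinals $\lambda$. The solvable ranking $|y|_{SV}$ is the least ordinal $\alpha$ such that $E_\alpha=\emptyset$. Let $S_n(y,t)=\sum_{|k|\le n}\hat y(k)e^{ikt}$ be the symmetric partial sums of the Fourier series of $y$. For closed $P\subseteq\mathbb{T}$ and $x\in P$ put $$\omega(x,y,P)=\inf_{\delta>0}\ \inf_{p\in\mathbb{N}}\ \sup\bigl\{|S_m(y,t)-S_n(y,t)| : m,n\ge p,\ t\in P,\ |t-x|<\delta\bigr\},$$ where $|t-x|$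 is the distance on $\mathbb{T}$. For $\varepsilon>0$ let $P'_{\varepsilon,y}=\{x\in P:\omega(x,y,P)\ge\varepsilon\}$, and put $P^0_{\varepsilon,y}=\mathbb{T}$, $P^{\alpha+1}_{\varepsilon,y}=(P^\alpha_{\varepsilon,y})'_{\varepsilon,y}$, and $P^\lambda_{\varepsilon,y}=\bigcap_{\beta<\lambda}P^\beta_{\varepsilon,y}$ for limit $\lambda$. The Zalcwasser ranking $|y|_Z$ is the least ordinal $\alpha$ such that $P^\alpha_{\varepsilon,y}=\emptyset$ for all $\varepsilon>0$. Then for every $y\in SV(\mathbb{T})$ both rankings are well defined and countable (that is, $E_\alpha=\emptyset$ for some $\alpha<\omega_1$, and there is $\alpha<\omega_1$ with $P^\alpha_{\varepsilon,y}=\emptyset$ for all $\varepsilon>0$), and $$|y|_{SV}\ \ge\ |y|_Z .$$ -/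

import Mathlib

open scoped Ordinal ENNReal

namespace SolvableRank

noncomputable section

/-! ### Transfinite iteration of a set derivative -/

/-- The transfinite sequence generated by an operation `D` on subsets of `X`: it starts with the
whole space, applies `D` at successors and takes intersections at limits. -/
def transIter {X : Type*} (D : Set X → Set X) (α : Ordinal.{0}) : Set X :=
  Ordinal.limitRecOn α Set.univ (fun _ S => D S)
    (fun α _ S => ⋂ (β : Ordinal.{0}) (h : β < α), S β h)

theorem transIter_zero {X : Type*} (D : Set X → Set X) : transIter D 0 = Set.univ := by
  simp [transIter]

theorem transIter_add_one {X : Type*} (D : Set X → Set X) (α : Ordinal.{0}) :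
    transIter D (α + 1) = D (transIter D α) := by
  simp [transIter]

theorem transIter_limit {X : Type*} (D : Set X → Set X) (α : Ordinal.{0})
    (hα : Order.IsSuccLimit α) :
    transIter D α = ⋂ (β : Ordinal.{0}) (_ : β < α), transIter D β := by
  unfold transIter
  rw [Ordinal.limitRecOn_limit _ _ _ _ hα]

/-! ### Solvable functions and removed sets -/

section General

variable {X Y : Type*} [TopologicalSpace X] [TopologicalSpace Y]

/-- The set of discontinuity points of the restriction of `f` to `K`, continuity being meant
for the subspace topology of `K`. -/
def discontSet (f : X → Y) (K : Set X) : Set X :=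
  {x | x ∈ K ∧ ¬ ContinuousWithinAt f K x}

/-- `f` is of Baire class one: a pointwise limit of a sequence of continuous functions. -/
def IsBaireOne (f : X → Y) : Prop :=
  ∃ g : ℕ → X → Y, (∀ n, Continuous (g n)) ∧
    ∀ x, Filter.Tendsto (fun n => g n x) Filter.atTop (nhds (f x))

/-- `f` is solvable: it is of Baire class one and for every closed set `K` the set of
discontinuity points of the restriction of `f` to `K` is closed. -/
def IsSolvable (f : X → Y) : Prop :=
  IsBaireOne f ∧ ∀ K : Set X, IsClosed K → IsClosed (discontSet f K)

/-- The sequence `E_α` of `f`-removed sets on `X`. -/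
def removedSet (f : X → Y) (α : Ordinal.{0}) : Set X :=
  transIter (discontSet f) α

end General

/-! ### The unit circle and the solvable ranking -/

instance fact_two_pi_pos : Fact (0 < 2 * Real.pi) := ⟨Real.two_pi_pos⟩

/-- The unit circle, i.e. `[0, 2π]` with the end points identified. -/
abbrev Torus : Type := AddCircle (2 * Real.pi)

/-- `y` is differentiable at every point of the circle. -/
def IsDiff (y : Torus → ℝ) : Prop :=
  ∀ x : Torus, DifferentiableAt ℝ (fun h : ℝ => y (x + (h : Torus))) 0

/-- The derivative of a function on the circle, as a function on the circle. -/
def torusDeriv (y : Torus → ℝ) (x : Torus) : ℝ :=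
  deriv (fun h : ℝ => y (x + (h : Torus))) 0

/-- `y ∈ SV(𝕋)`: `y` is differentiable and its derivative is bounded and solvable. -/
def IsSV (y : Torus → ℝ) : Prop :=
  IsDiff y ∧ (∃ C : ℝ, ∀ x, |torusDeriv y x| ≤ C) ∧ IsSolvable (torusDeriv y)

/-- The solvable ranking: the least `α` such that the `α`-th `y'`-removed set is empty. -/
def solvableRank (y : Torus → ℝ) : Ordinal.{0} :=
  sInf {α | removedSet (torusDeriv y) α = ∅}

/-! ### The Zalcwasser ranking -/

/-- The symmetric partial sum `S_N(y, t) = ∑_{|n| ≤ N} c_n e^{int}` of the Fourier series,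
where `c_n = (1 / 2π) ∫_0^{2π} y(s) e^{-ins} ds`. -/
def fourierPartialSum (y : Torus → ℝ) (N : ℕ) (t : Torus) : ℂ :=
  ∑ n ∈ Finset.Icc (-(N : ℤ)) (N : ℤ), fourierCoeff (fun s : Torus => (y s : ℂ)) n * fourier n t

/-- The oscillation at `x` of the Fourier series of `y` on `P`:
`inf_{δ > 0} inf_p sup {|S_m(y, t) - S_n(y, t)| : m, n ≥ p, t ∈ P, |t - x| < δ}`. -/
def fourierOsc (y : Torus → ℝ) (P : Set Torus) (x : Torus) : ℝ≥0∞ :=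
  ⨅ (δ : ℝ) (_ : 0 < δ) (p : ℕ), ⨆ (m : ℕ) (_ : p ≤ m) (n : ℕ) (_ : p ≤ n)
    (t : Torus) (_ : t ∈ P ∧ dist t x < δ),
    ‖fourierPartialSum y m t - fourierPartialSum y n t‖ₑ

/-- The derivative of `P`: the points of `P` at which the oscillation on `P` is at least `ε`. -/
def zalcDeriv (y : Torus → ℝ) (ε : ℝ) (P : Set Torus) : Set Torus :=
  {x | x ∈ P ∧ ENNReal.ofReal ε ≤ fourierOsc y P x}

/-- The iterated derivatives of the circle for given `y` and `ε`. -/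
def zalcSet (y : Torus → ℝ) (ε : ℝ) (α : Ordinal.{0}) : Set Torus :=
  transIter (zalcDeriv y ε) α

/-- The Zalcwasser ranking: the least `α` such that the `α`-th derivative is empty for
every `ε > 0`. -/
def zalcwasserRank (y : Torus → ℝ) : Ordinal.{0} :=
  sInf {α | ∀ ε : ℝ, 0 < ε → zalcSet y ε α = ∅}

end

end SolvableRank

open Set Filter Topology MeasureTheory

namespace SolvableRank

/-! ### Transfinite iterations of a set derivative -/

section TransIter

variable {X : Type*} {D : Set X → Set X}

/-! The inequality holds because the Zalcwasser rank is at most 1 and the solvable rank at least 1.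
A bounded derivative is in L², so its Fourier coefficients are square summable; integration by parts
then makes those of `y` absolutely summable (`summable_norm_fourierCoeff`). The partial sums are
uniformly Cauchy, every oscillation vanishes, and the first derived set is empty
(`zalcSet_one_eq_empty`). Stage 0 of the removed sets is the whole circle, hence nonempty.

Countability of the solvable rank is a Cantor–Bendixson argument (`exists_transIter_eq_empty`);
strict decrease comes from Baire's theorem on continuity points (`IsBaireOne.discontSet_ne`). -/

theorem transIter_antitone (hD : ∀ S, D S ⊆ S) : Antitone (transIter D) := by
  intro β α h
  induction α using Ordinal.limitRecOn with
  | zero => rw [nonpos_iff_eq_zero.mp h]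
  | add_one α ih =>
    rcases h.eq_or_lt with rfl | h
    · exact le_rfl
    · rw [transIter_add_one]
      exact (hD _).trans (ih (Order.lt_add_one_iff.mp h))
  | limit α hα ih =>
    rcases h.eq_or_lt with rfl | h
    · exact le_rfl
    · rw [transIter_limit D α hα]
      exact iInter₂_subset β h

theorem isClosed_transIter [TopologicalSpace X] (hD : ∀ S, IsClosed S → IsClosed (D S))
    (α : Ordinal.{0}) : IsClosed (transIter D α) := by
  induction α using Ordinal.limitRecOn with
  | zero => rw [transIter_zero]; exact isClosed_univ
  | add_one α ih => rw [transIter_add_one]; exact hD _ ih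
  | limit α hα ih =>
    rw [transIter_limit D α hα]
    exact isClosed_biInter ih

/-- In a second countable space, a derivative of closed sets that shrinks every nonempty closed
set reaches the empty set after countably many steps. -/
theorem exists_transIter_eq_empty [TopologicalSpace X] [SecondCountableTopology X]
    (hsub : ∀ S, D S ⊆ S) (hcl : ∀ S, IsClosed S → IsClosed (D S))
    (hne : ∀ S, IsClosed S → S.Nonempty → D S ≠ S) :
    ∃ α : Ordinal.{0}, α < ω₁ ∧ transIter D α = ∅ := by
  by_contra! hcon
  -- The basic open set `U` witnesses the loss of a point between stages `α` and `α + 1`. Distinct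
  -- `α` need distinct witnesses, which would inject `ω₁` into a countable basis.
  have key : ∀ α : Iio (ω₁ : Ordinal.{0}), ∃ U : TopologicalSpace.countableBasis X,
      (U.1 ∩ transIter D α).Nonempty ∧ U.1 ∩ transIter D (α + 1) = ∅ := by
    rintro ⟨α, hα⟩
    have hssub : transIter D (α + 1) ⊂ transIter D α := by
      rw [transIter_add_one]
      exact (hsub _).ssubset_of_ne (hne _ (isClosed_transIter hcl α) (hcon α hα))
    obtain ⟨x, hx, hx'⟩ := exists_of_ssubset hssub
    obtain ⟨U, hU, hxU, hUs⟩ := (TopologicalSpace.isBasis_countableBasis X).exists_subset_of_mem_open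
      (mem_compl hx') (isClosed_transIter hcl (α + 1)).isOpen_compl
    exact ⟨⟨U, hU⟩, ⟨x, hxU, hx⟩, (subset_compl_iff_disjoint_right.mp hUs).inter_eq⟩
  choose U hU hU' using key
  have hlt : ∀ α β, α < β → U α ≠ U β := by
    intro α β h heq
    obtain ⟨x, hxU, hx⟩ := hU β
    have hle : (α : Ordinal.{0}) + 1 ≤ β := Order.add_one_le_of_lt h
    have : x ∈ (U α).1 ∩ transIter D (α + 1) := ⟨heq ▸ hxU, transIter_antitone hsub hle hx⟩
    rw [hU' α] at this
    exact this
  have hinj : Function.Injective U := by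
    intro α β h
    rcases lt_trichotomy α β with h' | h' | h'
    · exact absurd h (hlt _ _ h')
    · exact h'
    · exact absurd h.symm (hlt _ _ h')
  have hcount : Countable (Iio (ω₁ : Ordinal.{0})) := hinj.countable
  rw [← Cardinal.mk_le_aleph0_iff, Cardinal.mk_Iio_ordinal, Cardinal.lift_le_aleph0,
    Ordinal.card_omega] at hcount
  exact absurd hcount Cardinal.aleph0_lt_aleph_one.not_ge

end TransIter

/-! ### Continuity points of functions of Baire class one -/

section BaireOne

variable {X Y : Type*} [TopologicalSpace X]

theorem IsBaireOne.comp_continuous {Z : Type*} [TopologicalSpace Y] [TopologicalSpace Z]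
    {f : X → Y} (hf : IsBaireOne f) {g : Z → X} (hg : Continuous g) : IsBaireOne (f ∘ g) := by
  obtain ⟨u, hu, hlim⟩ := hf
  exact ⟨fun n => u n ∘ g, fun n => (hu n).comp hg, fun x => hlim (g x)⟩

/-- For each `k`, pointwise convergence covers `X` by the closed sets `F k n`, so by Baire category
their interiors have dense union. A point lying in such a union for every `k` is a continuity point.
-/
theorem IsBaireOne.dense_continuousAt [BaireSpace X] [PseudoMetricSpace Y] {f : X → Y}
    (hf : IsBaireOne f) : Dense {x | ContinuousAt f x} := by
  obtain ⟨g, hg, hlim⟩ := hf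
  let F : ℕ → ℕ → Set X := fun k n =>
    {x | ∀ i, n ≤ i → ∀ j, n ≤ j → dist (g i x) (g j x) ≤ 1 / ((k : ℝ) + 1)}
  have hF : ∀ k n, IsClosed (F k n) := by
    intro k n
    simp only [F, ofPred_forall]
    exact isClosed_iInter fun i => isClosed_iInter fun _ => isClosed_iInter fun j =>
      isClosed_iInter fun _ => isClosed_le ((hg i).dist (hg j)) continuous_const
  have hcover : ∀ k, ⋃ n, F k n = univ := by
    intro k
    refine eq_univ_of_forall fun x => ?_
    obtain ⟨n, hn⟩ := Metric.cauchySeq_iff.mp (hlim x).cauchySeq (1 / ((k : ℝ) + 1))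
      Nat.one_div_pos_of_nat
    exact mem_iUnion.mpr ⟨n, fun i hi j hj => (hn i hi j hj).le⟩
  refine (dense_iInter_of_isOpen (fun k => isOpen_iUnion fun n => isOpen_interior (s := F k n))
    fun k => dense_iUnion_interior_of_closed (hF k) (hcover k)).mono fun x hx => ?_
  refine Metric.continuousAt_iff'.mpr fun ε hε => ?_
  obtain ⟨k, hk⟩ := exists_nat_one_div_lt (show 0 < ε / 3 by positivity)
  obtain ⟨n, hn⟩ := mem_iUnion.mp (mem_iInter.mp hx k)
  have hclose : ∀ z ∈ F k n, dist (g n z) (f z) ≤ 1 / ((k : ℝ) + 1) := fun z hz =>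
    le_of_tendsto (tendsto_const_nhds.dist (hlim z))
      (eventually_atTop.mpr ⟨n, fun j hj => hz n le_rfl j hj⟩)
  filter_upwards [isOpen_interior.mem_nhds hn,
    Metric.continuousAt_iff'.mp (hg n).continuousAt (ε / 3) (by positivity)] with z hz hz'
  have h1 := hclose z (interior_subset hz)
  have h2 := hclose x (interior_subset hn)
  have h3 := dist_triangle4 (f z) (g n z) (g n x) (f x)
  rw [dist_comm (f z) (g n z)] at h3
  linarith

/-- A closed `K` is itself compact Hausdorff, hence a Baire space, so the restriction to `K` has a
continuity point. -/
theorem IsBaireOne.discontSet_ne [CompactSpace X] [T2Space X] [PseudoMetricSpace Y] {f : X → Y}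
    (hf : IsBaireOne f) {K : Set X} (hK : IsClosed K) (hne : K.Nonempty) :
    discontSet f K ≠ K := by
  have : CompactSpace K := isCompact_iff_compactSpace.mp hK.isCompact
  have : Nonempty K := hne.to_subtype
  obtain ⟨x, hx⟩ := (hf.comp_continuous (continuous_subtype_val (p := (· ∈ K)))).dense_continuousAt
    |>.nonempty
  intro h
  have hx' : x.1 ∈ discontSet f K := h.ge x.2
  exact hx'.2 ((continuousWithinAt_iff_continuousAt_domRestrict f x.2).mpr hx)

/-- The removed sets of a solvable function vanish at some countable stage. -/
theorem IsSolvable.exists_removedSet_eq_empty [CompactSpace X] [T2Space X]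
    [SecondCountableTopology X] [PseudoMetricSpace Y] {f : X → Y} (hf : IsSolvable f) :
    ∃ α : Ordinal.{0}, α < ω₁ ∧ removedSet f α = ∅ :=
  exists_transIter_eq_empty (fun _ _ hx => hx.1) hf.2 fun _ hS hne => hf.1.discontSet_ne hS hne

end BaireOne

/-! ### Fourier series of functions with bounded derivative -/

theorem IsDiff.hasDerivAt {y : Torus → ℝ} (hy : IsDiff y) (s : ℝ) :
    HasDerivAt (fun s : ℝ => y (s : Torus)) (torusDeriv y s) s := by
  have h : HasDerivAt (fun h : ℝ => y ((s : Torus) + (h : Torus))) (torusDeriv y s) (s - s) := by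
    rw [sub_self]
    exact (hy s).hasDerivAt
  have h' := h.comp_sub_const s s
  refine h'.congr_of_eventuallyEq (Eventually.of_forall fun t => ?_)
  simp

/-- The Fourier coefficients of a differentiable function with bounded derivative are absolutely
summable. -/
theorem summable_norm_fourierCoeff {y : Torus → ℝ} (hy : IsDiff y)
    (hb : ∃ C : ℝ, ∀ x, |torusDeriv y x| ≤ C) :
    Summable fun n => ‖fourierCoeff (fun s : Torus => (y s : ℂ)) n‖ := by
  obtain ⟨C, hC⟩ := hb
  have hab : (0 : ℝ) < 0 + 2 * Real.pi := by simpa using Real.two_pi_pos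
  set f : ℝ → ℂ := fun s => (y (s : Torus) : ℂ) with hf_def
  set f' : ℝ → ℂ := fun s => (torusDeriv y (s : Torus) : ℂ) with hf'_def
  have hcoeff : ∀ n, fourierCoeff (fun s : Torus => (y s : ℂ)) n = fourierCoeffOn hab f n := by
    intro n
    rw [fourierCoeffOn_eq_integral, fourierCoeff_eq_intervalIntegral _ n 0, add_sub_cancel_left]
  have hderiv : ∀ s, HasDerivAt f (f' s) s := fun s => (hy.hasDerivAt s).ofReal_comp
  have hmeas : Measurable f' := by
    have : f' = deriv f := funext fun s => (hderiv s).deriv.symm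
    rw [this]
    exact measurable_deriv f
  have hbound : ∀ s, ‖f' s‖ ≤ C := fun s => by simpa [hf'_def] using hC s
  have hL2 : MemLp f' 2 (volume.restrict (Ioc 0 (0 + 2 * Real.pi))) :=
    MemLp.of_bound hmeas.aestronglyMeasurable C (Eventually.of_forall hbound)
  have hint : IntervalIntegrable f' volume 0 (0 + 2 * Real.pi) := by
    rw [intervalIntegrable_iff_integrableOn_Ioc_of_le hab.le]
    exact hL2.integrable (by norm_num)
  have hper : f (0 + 2 * Real.pi) = f 0 := by
    simp only [hf_def]
    rw [AddCircle.coe_add, AddCircle.coe_period, add_zero]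
  -- This majorant comes from `ab ≤ a² + b²` applied to `1/|n|` and the coefficient of `f'`;
  -- Parseval sums the second term.
  have hsum : Summable fun n : ℤ => 1 / (n : ℝ) ^ 2 + ‖fourierCoeffOn hab f' n‖ ^ 2 :=
    (Real.summable_one_div_int_pow.mpr one_lt_two).add (hasSum_sq_fourierCoeffOn hab hL2).summable
  refine hsum.of_norm_bounded_eventually (Filter.eventually_cofinite_ne 0 |>.mono fun n hn => ?_)
  have hn' : (0 : ℝ) < |(n : ℝ)| := abs_pos.mpr (Int.cast_ne_zero.mpr hn)
  have hpi := Real.pi_pos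
  -- Integration by parts needs only integrability of `f'`; periodicity kills the boundary term.
  rw [hcoeff, fourierCoeffOn_of_hasDerivAt hab hn (fun s _ => hderiv s) hint, hper, norm_norm]
  have hnorm : ‖1 / (-2 * Real.pi * Complex.I * n) * (fourier (-n) ((0 : ℝ) : AddCircle
      (0 + 2 * Real.pi - 0)) * (f 0 - f 0) - ((0 + 2 * Real.pi : ℝ) - (0 : ℝ) : ℂ) *
      fourierCoeffOn hab f' n)‖ = 1 / |(n : ℝ)| * ‖fourierCoeffOn hab f' n‖ := by
    simp [abs_of_pos hpi]
    field_simp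
  have hsq : 1 / (n : ℝ) ^ 2 = (1 / |(n : ℝ)|) ^ 2 := by rw [div_pow, one_pow, sq_abs]
  rw [hsq]
  refine (le_of_eq ?_).trans
    (show 1 / |(n : ℝ)| * ‖fourierCoeffOn hab f' n‖ ≤ _ by
      nlinarith [sq_nonneg (1 / |(n : ℝ)| - ‖fourierCoeffOn hab f' n‖),
        sq_nonneg (1 / |(n : ℝ)|), sq_nonneg ‖fourierCoeffOn hab f' n‖])
  exact hnorm

/-- If the Fourier coefficients are absolutely summable, the partial sums are uniformly Cauchy. -/
theorem exists_norm_fourierPartialSum_sub_lt {y : Torus → ℝ}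
    (hs : Summable fun n => ‖fourierCoeff (fun s : Torus => (y s : ℂ)) n‖) {ε : ℝ} (hε : 0 < ε) :
    ∃ p : ℕ, ∀ m, p ≤ m → ∀ n, p ≤ n → ∀ t,
      ‖fourierPartialSum y m t - fourierPartialSum y n t‖ < ε := by
  obtain ⟨s, hsum⟩ := summable_iff_vanishing_norm.mp hs ε hε
  have hsub : ∃ p : ℕ, s ⊆ Finset.Icc (-(p : ℤ)) p := by
    refine ⟨s.sup Int.natAbs, fun k hk => ?_⟩
    have := Finset.le_sup (f := Int.natAbs) hk
    rw [Finset.mem_Icc]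
    omega
  obtain ⟨p, hp⟩ := hsub
  have key : ∀ m n : ℕ, p ≤ n → n ≤ m → ∀ t,
      ‖fourierPartialSum y m t - fourierPartialSum y n t‖ < ε := by
    intro m n hn hnm t
    have hIcc : Finset.Icc (-(n : ℤ)) n ⊆ Finset.Icc (-(m : ℤ)) m :=
      Finset.Icc_subset_Icc (by omega) (by omega)
    have hdisj : Disjoint (Finset.Icc (-(m : ℤ)) m \ Finset.Icc (-(n : ℤ)) n) s :=
      Finset.sdiff_disjoint.mono_right
        (hp.trans (Finset.Icc_subset_Icc (by omega) (by omega)))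
    rw [fourierPartialSum, fourierPartialSum, ← Finset.sum_sdiff hIcc, add_sub_cancel_right]
    refine (norm_sum_le _ _).trans_lt (lt_of_le_of_lt (le_of_eq ?_)
      ((le_abs_self _).trans_lt (hsum _ hdisj)))
    exact Finset.sum_congr rfl fun k _ => by simp [fourier_apply, Circle.norm_coe]
  refine ⟨p, fun m hm n hn t => ?_⟩
  rcases le_total n m with h | h
  · exact key m n hn h t
  · rw [norm_sub_rev]
    exact key n m hm h t

theorem fourierOsc_eq_zero {y : Torus → ℝ}
    (hs : Summable fun n => ‖fourierCoeff (fun s : Torus => (y s : ℂ)) n‖)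
    (P : Set Torus) (x : Torus) : fourierOsc y P x = 0 := by
  refine nonpos_iff_eq_zero.mp (ENNReal.le_of_forall_pos_le_add fun ε hε _ => ?_)
  obtain ⟨p, hp⟩ := exists_norm_fourierPartialSum_sub_lt hs (NNReal.coe_pos.mpr hε)
  rw [zero_add]
  refine (iInf₂_le_of_le 1 one_pos (iInf_le _ p)).trans ?_
  refine iSup₂_le fun m hm => iSup₂_le fun n hn => iSup₂_le fun t _ => ?_
  rw [enorm_le_coe]
  exact (hp m hm n hn t).le

theorem zalcSet_one_eq_empty {y : Torus → ℝ}
    (hs : Summable fun n => ‖fourierCoeff (fun s : Torus => (y s : ℂ)) n‖) {ε : ℝ} (hε : 0 < ε) :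
    zalcSet y ε 1 = ∅ := by
  rw [zalcSet, ← zero_add (1 : Ordinal.{0}), transIter_add_one]
  refine eq_empty_of_forall_notMem fun x hx => ?_
  have h := hx.2
  rw [fourierOsc_eq_zero hs, nonpos_iff_eq_zero, ENNReal.ofReal_eq_zero] at h
  exact hε.not_ge h

theorem one_le_of_removedSet_eq_empty {X Y : Type*} [TopologicalSpace X] [TopologicalSpace Y]
    [Nonempty X] {f : X → Y} {α : Ordinal.{0}} (h : removedSet f α = ∅) : 1 ≤ α := by
  rw [Order.one_le_iff_pos, pos_iff_ne_zero]
  rintro rfl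
  rw [removedSet, transIter_zero] at h
  exact univ_nonempty.ne_empty h

end SolvableRank

theorem mainTheorem5 (y : SolvableRank.Torus → ℝ) (hy : SolvableRank.IsSV y) :
    (∃ α : Ordinal.{0}, α < ω₁ ∧
      SolvableRank.removedSet (SolvableRank.torusDeriv y) α = ∅) ∧
    (∃ α : Ordinal.{0}, α < ω₁ ∧
      ∀ ε : ℝ, 0 < ε → SolvableRank.zalcSet y ε α = ∅) ∧
    SolvableRank.zalcwasserRank y ≤ SolvableRank.solvableRank y := by
  obtain ⟨hdiff, hbdd, hsolv⟩ := hy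
  have hex := hsolv.exists_removedSet_eq_empty
  have hzalc : ∀ ε : ℝ, 0 < ε → SolvableRank.zalcSet y ε 1 = ∅ := fun _ hε =>
    SolvableRank.zalcSet_one_eq_empty (SolvableRank.summable_norm_fourierCoeff hdiff hbdd) hε
  refine ⟨hex, ⟨1, Ordinal.one_lt_omega0.trans Ordinal.omega0_lt_omega_one, hzalc⟩, ?_⟩
  obtain ⟨α, -, hα⟩ := hex
  calc SolvableRank.zalcwasserRank y ≤ 1 := csInf_le' hzalc
    _ ≤ SolvableRank.solvableRank y :=
      -- A vanishing stage is required here, since the infimum of an empty set of ordinals is 0.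
      le_csInf ⟨α, hα⟩ fun _ => SolvableRank.one_le_of_removedSet_eq_empty
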